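/- Let $G$ be a topological group. Let $B(G)$ be its Fourier--Stieltjes algebra, i.e. the algebra of all matrix coefficients $g\mapsto\langle v,\pi(g)w\rangle$ of strongly continuous unitary representations $\pi$ of $G$ on complex Hilbert spaces; let $\mathrm{Hilb}(G)$ be the closure of $B(G)$ in the uniform norm in the algebra of bounded continuous functions $G\to\mathbb{C}$, and let the Hilbert compactification $H(G)$ be the Gelfand space of $\mathrm{Hilb}(G)$ (the unital algebra homomorphisms $\mathrm{Hilb}(G)\to\mathbb{C}$ with the topology of pointwise convergence), with the $G$-action $(gx)(f)=x(g^{-1}f)$, where $(gf)(h)=f(g^{-1}h)$, and the canonical map $\alpha\colon G\to H(G)$, $\alpha(g)(f)=f(g)$. A compactification of $G$ is a compact Hausdorff space $Y$ with a jointly continuous $G$-action and a continuous $G$-map $\beta\colon G\to Y$ with dense image; it is a factor of $H(G)$ if there is a continuous surjective $G$-map $p\colon H(G)\to Y$ with $\beta=p\circ\alpha$. The group $G$ is Roelcke precompact if for every neighbourhood $U$ of the identity there is a finite set $F\subseteq G$ with $UFU=G$; it is pro-oligomorphic if it is Polish, Roelcke precompact and non-archimedean (the identity has a basis of neighbourhoods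 consisting of open subgroups). (1) If $G$ is pro-oligomorphic, then every factor of $H(G)$ is zero-dimensional, i.e. has a basis of clopen sets. (2) If $G$ is Polish and Roelcke precompact (in particular, if $G$ is pro-oligomorphic), and $f\colon H(G)\to\mathbb{C}$ is a continuous function for which there is an open subgroup $V\le G$ with $f(v^{-1}x)=f(x)$ for all $v\in V$ and $x\in H(G)$, then $f(H(G))$ is countable. -/

import Mathlib

open Topology TopologicalSpace Set
open scoped BoundedContinuousFunction Pointwise TensorProduct

universe u v

set_option linter.unusedSectionVars false

noncomputable section

namespace HilbertComp

/-- `f` is a matrix coefficient `g ↦ ⟨v, π(g) w⟩` of a strongly continuous unitary representation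
`π` of `G` on a complex Hilbert space. (Every matrix coefficient lives on a cyclic subspace, whose
size is bounded in terms of `G`, so Hilbert spaces in the universe of `G` suffice.) -/
def IsMatrixCoeff {G : Type u} [Group G] [TopologicalSpace G] (f : G → ℂ) : Prop :=
  ∃ (H : Type u) (_ : NormedAddCommGroup H) (_ : InnerProductSpace ℂ H) (_ : CompleteSpace H)
    (π : G →* (H ≃ₗᵢ[ℂ] H)) (v w : H),
    (∀ x : H, Continuous fun g : G => π g x) ∧ ∀ g : G, f g = inner ℂ v (π g w)

section Coefficients

variable {G : Type u} [Group G] [TopologicalSpace G]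

/-- A matrix coefficient of a representation on a pre-Hilbert space is one on its completion. -/
theorem IsMatrixCoeff.of_pre {E : Type u} [NormedAddCommGroup E] [InnerProductSpace ℂ E]
    (U : G → E →ₗᵢ[ℂ] E) (h1 : ∀ x, U 1 x = x) (hm : ∀ g h x, U (g * h) x = U g (U h x))
    (hc : ∀ x, Continuous fun g => U g x) (v w : E) {f : G → ℂ}
    (hf : ∀ g, f g = inner ℂ v (U g w)) : IsMatrixCoeff f := by
  let V : G → UniformSpace.Completion E →L[ℂ] UniformSpace.Completion E :=
    fun g => (U g).toContinuousLinearMap.completion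
  have Vcoe : ∀ g (x : E), V g (x : UniformSpace.Completion E) = ((U g x : E) :) := fun g x =>
    ContinuousLinearMap.completion_apply_coe (U g).toContinuousLinearMap x
  have Vnorm : ∀ g x, ‖V g x‖ = ‖x‖ := by
    intro g x
    induction x using UniformSpace.Completion.induction_on with
    | hp => exact isClosed_eq (by fun_prop) (by fun_prop)
    | ih a => rw [Vcoe]; simp
  have V1 : ∀ x, V 1 x = x := by
    intro x
    induction x using UniformSpace.Completion.induction_on with
    | hp => exact isClosed_eq (by fun_prop) (by fun_prop)
    | ih a => rw [Vcoe, h1]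
  have Vm : ∀ g h x, V (g * h) x = V g (V h x) := by
    intro g h x
    induction x using UniformSpace.Completion.induction_on with
    | hp => exact isClosed_eq (by fun_prop) (by fun_prop)
    | ih a => rw [Vcoe, Vcoe, Vcoe, hm]
  let π : G →* (UniformSpace.Completion E ≃ₗᵢ[ℂ] UniformSpace.Completion E) :=
    { toFun := fun g =>
        { toFun := V g
          invFun := V g⁻¹
          map_add' := map_add _
          map_smul' := map_smul _
          left_inv := fun x => by rw [← Vm, inv_mul_cancel, V1]
          right_inv := fun x => by rw [← Vm, mul_inv_cancel, V1]
          norm_map' := Vnorm g }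
      map_one' := by ext x; exact V1 x
      map_mul' := fun g h => by ext x; exact Vm g h x }
  have hπ : ∀ g x, π g x = V g x := fun _ _ => rfl
  refine ⟨UniformSpace.Completion E, inferInstance, inferInstance, inferInstance, π, v, w, ?_, ?_⟩
  · intro x
    simp only [hπ]
    rw [continuous_iff_continuousAt]
    intro g₀
    rw [ContinuousAt, Metric.tendsto_nhds]
    intro ε hε
    obtain ⟨a, ha⟩ : ∃ a : E, dist x (a : UniformSpace.Completion E) < ε / 3 :=
      (UniformSpace.Completion.denseRange_coe (α := E)).exists_dist_lt x (by positivity)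
    filter_upwards [(Metric.tendsto_nhds.1 ((hc a).tendsto g₀)) (ε / 3) (by positivity)] with g hg
    have e : ∀ k, dist (V k x) (V k a) < ε / 3 := fun k => by
      rw [dist_eq_norm, ← map_sub, Vnorm, ← dist_eq_norm]; exact ha
    have e2 : dist (V g a) (V g₀ a) < ε / 3 := by
      rw [Vcoe, Vcoe, UniformSpace.Completion.dist_eq]; exact hg
    have e3 := e g₀
    rw [dist_comm] at e3
    linarith [e g, dist_triangle4 (V g x) (V g a) (V g₀ a) (V g₀ x)]
  · intro g
    rw [hπ, Vcoe, UniformSpace.Completion.inner_coe, hf]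

theorem IsMatrixCoeff.const (c : ℂ) : IsMatrixCoeff (fun _ : G => c) := by
  refine IsMatrixCoeff.of_pre (E := EuclideanSpace ℂ PUnit.{u + 1}) (fun _ => LinearIsometry.id)
    (fun _ => rfl) (fun _ _ _ => rfl) (fun _ => continuous_const)
    (EuclideanSpace.single PUnit.unit 1) (EuclideanSpace.single PUnit.unit c) ?_
  intro g
  simp [EuclideanSpace.inner_single_left]

theorem IsMatrixCoeff.add {f₁ f₂ : G → ℂ} (h₁ : IsMatrixCoeff f₁) (h₂ : IsMatrixCoeff f₂) :
    IsMatrixCoeff (fun g => f₁ g + f₂ g) := by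
  obtain ⟨H, _, _, _, π, v, w, hc, hf⟩ := h₁
  obtain ⟨K, _, _, _, ρ, v', w', hc', hf'⟩ := h₂
  refine IsMatrixCoeff.of_pre (E := WithLp 2 (H × K))
    (fun g =>
      { toFun := fun x => WithLp.toLp 2 (π g x.fst, ρ g x.snd)
        map_add' := fun x y => by apply WithLp.ofLp_injective; ext <;> simp
        map_smul' := fun c x => by apply WithLp.ofLp_injective; ext <;> simp
        norm_map' := fun x => by simp [WithLp.prod_norm_eq_of_L2] })
    ?_ ?_ ?_ (WithLp.toLp 2 (v, v')) (WithLp.toLp 2 (w, w')) ?_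
  · intro x; apply WithLp.ofLp_injective; ext <;> simp
  · intro g h x; apply WithLp.ofLp_injective; ext <;> simp
  · intro x
    exact (WithLp.prod_continuous_toLp 2 H K).comp ((hc _).prodMk (hc' _))
  · intro g
    simp [hf, hf', WithLp.prod_inner_apply]

theorem IsMatrixCoeff.mul {f₁ f₂ : G → ℂ} (h₁ : IsMatrixCoeff f₁) (h₂ : IsMatrixCoeff f₂) :
    IsMatrixCoeff (fun g => f₁ g * f₂ g) := by
  obtain ⟨H, _, _, _, π, v, w, hc, hf⟩ := h₁
  obtain ⟨K, _, _, _, ρ, v', w', hc', hf'⟩ := h₂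
  refine IsMatrixCoeff.of_pre (E := H ⊗[ℂ] K)
    (fun g => TensorProduct.mapIsometry (π g).toLinearIsometry (ρ g).toLinearIsometry)
    ?_ ?_ ?_ (v ⊗ₜ v') (w ⊗ₜ w') ?_
  · intro x
    induction x with
    | zero => simp
    | tmul a b => simp
    | add a b ha hb => rw [map_add, ha, hb]
  · intro g h x
    induction x with
    | zero => simp
    | tmul a b => simp
    | add a b ha hb => simp only [map_add, ha, hb]
  · intro x
    induction x with
    | zero => simpa using continuous_const
    | tmul a b =>
      simp only [TensorProduct.mapIsometry_apply, TensorProduct.map_tmul]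
      exact TensorProduct.continuous_tmul.comp ((hc a).prodMk (hc' b))
    | add a b ha hb => simp only [map_add]; exact ha.add hb
  · intro g
    simp [hf, hf']

/-- The conjugate of a complex inner product space. -/
def Conj (H : Type u) : Type u := H

instance {H : Type u} [NormedAddCommGroup H] : NormedAddCommGroup (Conj H) :=
  inferInstanceAs (NormedAddCommGroup H)

instance {H : Type u} [NormedAddCommGroup H] [InnerProductSpace ℂ H] : Module ℂ (Conj H) where
  smul c x := (starRingEnd ℂ c • (show H from x) : H)
  one_smul x := by change (starRingEnd ℂ 1 • (show H from x) : H) = x; rw [map_one]; exact one_smul ℂ (show H from x)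
  mul_smul a b x := by
    change (starRingEnd ℂ (a * b) • (show H from x) : H) =
      starRingEnd ℂ a • (starRingEnd ℂ b • (show H from x) : H)
    rw [map_mul, mul_smul]
  smul_zero a := smul_zero (A := H) (starRingEnd ℂ a)
  smul_add a x y := smul_add (A := H) (starRingEnd ℂ a) x y
  add_smul a b x := by
    change (starRingEnd ℂ (a + b) • (show H from x) : H) =
      (starRingEnd ℂ a • (show H from x) : H) + (starRingEnd ℂ b • (show H from x) : H)
    rw [map_add, add_smul]
  zero_smul x := by change (starRingEnd ℂ 0 • (show H from x) : H) = (0 : H); rw [map_zero, zero_smul]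

theorem Conj.smul_def {H : Type u} [NormedAddCommGroup H] [InnerProductSpace ℂ H] (c : ℂ)
    (x : Conj H) : c • x = (starRingEnd ℂ c • (show H from x) : H) := rfl

instance {H : Type u} [NormedAddCommGroup H] [InnerProductSpace ℂ H] :
    InnerProductSpace ℂ (Conj H) where
  norm_smul_le c x := by
    change ‖(starRingEnd ℂ c • (show H from x) : H)‖ ≤ ‖c‖ * ‖(show H from x)‖
    rw [norm_smul, RCLike.norm_conj]
  inner x y := inner ℂ (show H from y) (show H from x)
  norm_sq_eq_re_inner x := norm_sq_eq_re_inner (𝕜 := ℂ) (show H from x)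
  conj_inner_symm x y := inner_conj_symm (𝕜 := ℂ) (show H from y) (show H from x)
  add_left x y z := inner_add_right (𝕜 := ℂ) (show H from z) (show H from x) (show H from y)
  smul_left x y c := inner_smul_right (𝕜 := ℂ) (show H from y) (show H from x) (starRingEnd ℂ c)

theorem IsMatrixCoeff.conj {f : G → ℂ} (h : IsMatrixCoeff f) :
    IsMatrixCoeff (fun g => starRingEnd ℂ (f g)) := by
  obtain ⟨H, _, _, _, π, v, w, hc, hf⟩ := h
  refine IsMatrixCoeff.of_pre (E := Conj H)
    (fun g =>
      { toFun := fun x => (π g (show H from x) : H)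
        map_add' := fun x y => map_add (π g) (show H from x) (show H from y)
        map_smul' := fun c x => map_smul (π g) (starRingEnd ℂ c) (show H from x)
        norm_map' := fun x => (π g).norm_map (show H from x) })
    ?_ ?_ hc v w ?_
  · intro x
    change π 1 (show H from x) = x
    rw [map_one]; rfl
  · intro g h x
    change π (g * h) (show H from x) = π g (π h (show H from x))
    rw [map_mul]; rfl
  · intro g
    rw [hf]
    exact inner_conj_symm (𝕜 := ℂ) _ _

/-- The Fourier--Stieltjes algebra `B(G)`: all matrix coefficients of `G`, as a unital
`*`-subalgebra of the bounded continuous functions with the uniform norm. -/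
def fourierStieltjes (G : Type u) [Group G] [TopologicalSpace G] : StarSubalgebra ℂ (G →ᵇ ℂ) where
  carrier := {f | IsMatrixCoeff (f : G → ℂ)}
  mul_mem' := fun ha hb => ha.mul hb
  add_mem' := fun ha hb => ha.add hb
  algebraMap_mem' := fun c => IsMatrixCoeff.const c
  star_mem' := fun ha => ha.conj

/-- `Hilb(G)`: the uniform closure of the Fourier--Stieltjes algebra. -/
def hilb (G : Type u) [Group G] [TopologicalSpace G] : StarSubalgebra ℂ (G →ᵇ ℂ) :=
  (fourierStieltjes G).topologicalClosure

instance : CompleteSpace (hilb G) :=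
  (StarSubalgebra.isClosed_topologicalClosure _).completeSpace_coe

instance : CommCStarAlgebra (hilb G) where
  mul_comm := mul_comm

end Coefficients

section Compactifications

/-- `α : G → X` is a compactification of the topological group `G` (an ambit): `X` is a compact
Hausdorff space with a (jointly) continuous action of `G`, and `α` is a continuous `G`-map with
dense image. -/
structure IsCompactification {G : Type u} [Group G] [TopologicalSpace G] {X : Type v}
    [TopologicalSpace X] [MulAction G X] (α : G → X) : Prop where
  compactSpace : CompactSpace X
  t2Space : T2Space X
  continuousSMul : ContinuousSMul G X
  continuous : Continuous α
  map_mul : ∀ g h : G, α (g * h) = g • α h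
  denseRange : DenseRange α

/-- The compactification `β : G → Y` is a `G`-factor of the compactification `α : G → X`. -/
def IsFactor {G : Type*} [Group G] {X Y : Type*} [TopologicalSpace X] [MulAction G X]
    [TopologicalSpace Y] [MulAction G Y] (α : G → X) (β : G → Y) : Prop :=
  ∃ p : X → Y, Continuous p ∧ Function.Surjective p ∧ (∀ (g : G) (x : X), p (g • x) = g • p x) ∧
    β = p ∘ α

/-- A topological space is zero-dimensional if its clopen sets form a basis. -/
def IsZeroDimensional (X : Type*) [TopologicalSpace X] : Prop :=
  IsTopologicalBasis {s : Set X | IsClopen s}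

end Compactifications

section HilbertCompactification

variable {G : Type u} [Group G] [TopologicalSpace G] [IsTopologicalGroup G]

/-- The left action of `G` on bounded continuous functions, `(g f)(h) = f(g⁻¹ h)`. -/
def translate (g : G) (f : G →ᵇ ℂ) : G →ᵇ ℂ :=
  f.compContinuous ⟨fun h => g⁻¹ * h, by fun_prop⟩

theorem translate_apply (g : G) (f : G →ᵇ ℂ) (h : G) : translate g f h = f (g⁻¹ * h) := rfl

theorem dist_translate_le (g : G) (f f' : G →ᵇ ℂ) :
    dist (translate g f) (translate g f') ≤ dist f f' :=
  (BoundedContinuousFunction.dist_le dist_nonneg).2 fun h =>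
    BoundedContinuousFunction.dist_coe_le_dist (f := f) (g := f') (g⁻¹ * h)

theorem continuous_translate_right (g : G) : Continuous (translate g) :=
  (LipschitzWith.of_dist_le_mul (K := 1) fun f f' => by
    simpa using dist_translate_le g f f').continuous

theorem inner_map_inv_mul {H : Type*} [NormedAddCommGroup H] [InnerProductSpace ℂ H]
    (π : G →* (H ≃ₗᵢ[ℂ] H)) (v w : H) (g h : G) :
    inner ℂ v (π (g⁻¹ * h) w) = inner ℂ (π g v) (π h w) := by
  rw [← (π g).inner_map_map]
  congr 1
  change (π g * π (g⁻¹ * h)) w = _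
  rw [← map_mul, mul_inv_cancel_left]

theorem translate_mem_hilb (g : G) {f : G →ᵇ ℂ} (hf : f ∈ hilb G) : translate g f ∈ hilb G := by
  refine map_mem_closure (continuous_translate_right g) hf ?_
  rintro f ⟨H, _, _, _, π, v, w, hπ, hf⟩
  refine ⟨H, _, _, inferInstance, π, π g v, w, hπ, fun h => ?_⟩
  rw [translate_apply, hf, inner_map_inv_mul]

/-- Functions in `Hilb(G)` are right uniformly continuous. -/
theorem continuous_translate {f : G →ᵇ ℂ} (hf : f ∈ hilb G) :
    Continuous fun g : G => translate g f := by
  rw [continuous_iff_continuousAt]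
  intro g₀
  rw [ContinuousAt, Metric.tendsto_nhds]
  intro ε hε
  obtain ⟨f', ⟨H, _, _, _, π, v, w, hπ, hf'⟩, hff'⟩ :=
    Metric.mem_closure_iff.1 hf (ε / 3) (by positivity)
  have hδ : 0 < ε / 3 / (‖w‖ + 1) := by positivity
  filter_upwards [(Metric.tendsto_nhds.1 ((hπ v).tendsto g₀)) _ hδ] with g hg
  have h2 : dist (translate g f') (translate g₀ f') ≤ ε / 3 := by
    refine (BoundedContinuousFunction.dist_le (by positivity)).2 fun h => ?_
    rw [translate_apply, translate_apply, hf', hf', inner_map_inv_mul, inner_map_inv_mul,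
      dist_eq_norm, ← inner_sub_left]
    refine (norm_inner_le_norm _ _).trans ?_
    rw [LinearIsometryEquiv.norm_map, ← dist_eq_norm]
    rw [lt_div_iff₀ (by positivity)] at hg
    nlinarith [norm_nonneg w, dist_nonneg (x := π g v) (y := π g₀ v)]
  have h1 := dist_translate_le g f f'
  have h3 := dist_translate_le g₀ f f'
  rw [dist_comm] at h3
  linarith [dist_triangle4 (translate g f) (translate g f') (translate g₀ f') (translate g₀ f)]

/-- The left action of `g : G` on `Hilb(G)`, as a unital `*`-homomorphism. -/
def translateHom (g : G) : hilb G →⋆ₐ[ℂ] hilb G where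
  toFun f := ⟨translate g f, translate_mem_hilb g f.2⟩
  map_one' := rfl
  map_mul' _ _ := rfl
  map_zero' := rfl
  map_add' _ _ := rfl
  commutes' _ := rfl
  map_star' _ := rfl

/-- The Hilbert compactification `H(G)`: the Gelfand space of `Hilb(G)`, that is, the unital
algebra homomorphisms `Hilb(G) → ℂ` with the topology of pointwise convergence. -/
abbrev HilbertCompactification (G : Type u) [Group G] [TopologicalSpace G] : Type u :=
  WeakDual.characterSpace ℂ (hilb G)

/-- The action of `G` on `H(G)`: `(g x)(f) = x(g⁻¹ f)`. -/
instance : MulAction G (HilbertCompactification G) where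
  smul g x := WeakDual.CharacterSpace.compContinuousMap (translateHom g⁻¹) x
  one_smul x := by
    refine WeakDual.CharacterSpace.ext fun f => congrArg x ?_
    ext h
    change (f : G →ᵇ ℂ) ((1 : G)⁻¹⁻¹ * h) = _
    simp
  mul_smul a b x := by
    refine WeakDual.CharacterSpace.ext fun f => congrArg x ?_
    ext h
    change (f : G →ᵇ ℂ) ((a * b)⁻¹⁻¹ * h) = (f : G →ᵇ ℂ) (a⁻¹⁻¹ * (b⁻¹⁻¹ * h))
    simp [mul_assoc]

theorem smul_apply (g : G) (x : HilbertCompactification G) (f : hilb G) :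
    (g • x) f = x (translateHom g⁻¹ f) := rfl

/-- The canonical map `G → H(G)`, sending `g` to the evaluation at `g`. -/
def toHilbert (g : G) : HilbertCompactification G :=
  WeakDual.CharacterSpace.equivAlgHom.symm
    { toFun := fun f => (f : G →ᵇ ℂ) g
      map_one' := rfl
      map_mul' := fun _ _ => rfl
      map_zero' := rfl
      map_add' := fun _ _ => rfl
      commutes' := fun _ => rfl }

theorem toHilbert_apply (g : G) (f : hilb G) : toHilbert g f = (f : G →ᵇ ℂ) g := rfl

theorem continuous_eval (f : hilb G) : Continuous fun x : HilbertCompactification G => x f :=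
  (WeakDual.gelfandTransform ℂ (hilb G) f).continuous

/-- `G → H(G)` is a compactification of `G`. -/
theorem isCompactification_toHilbert :
    IsCompactification (toHilbert : G → HilbertCompactification G) where
  compactSpace := inferInstance
  t2Space := inferInstance
  continuousSMul := by
    refine ⟨Continuous.subtype_mk (WeakDual.continuous_of_continuous_eval fun f => ?_) _⟩
    rw [continuous_iff_continuousAt]
    rintro ⟨g₀, x₀⟩
    have key : Filter.Tendsto (fun p : G × HilbertCompactification G =>
        ‖translateHom p.1⁻¹ f - translateHom g₀⁻¹ f‖ + ‖p.2 (translateHom g₀⁻¹ f) -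
          x₀ (translateHom g₀⁻¹ f)‖) (𝓝 (g₀, x₀)) (𝓝 0) := by
      have c1 : Continuous fun g : G => translateHom g⁻¹ f :=
        ((continuous_translate f.2).comp continuous_inv).subtype_mk _
      have c2 := continuous_eval (translateHom g₀⁻¹ f)
      have c : Continuous (fun p : G × HilbertCompactification G =>
        ‖translateHom p.1⁻¹ f - translateHom g₀⁻¹ f‖ + ‖p.2 (translateHom g₀⁻¹ f) -
          x₀ (translateHom g₀⁻¹ f)‖) :=
        (((c1.comp continuous_fst).sub continuous_const).norm).add
          (((c2.comp continuous_snd).sub continuous_const).norm)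
      simpa using c.tendsto (g₀, x₀)
    refine tendsto_iff_norm_sub_tendsto_zero.2
      (squeeze_zero (fun _ => norm_nonneg _) (fun p => ?_) key)
    change ‖p.2 (translateHom p.1⁻¹ f) - x₀ (translateHom g₀⁻¹ f)‖ ≤ _
    calc _ = ‖p.2 (translateHom p.1⁻¹ f - translateHom g₀⁻¹ f) +
          (p.2 (translateHom g₀⁻¹ f) - x₀ (translateHom g₀⁻¹ f))‖ := by
            rw [map_sub]; congr 1; ring
      _ ≤ _ := (norm_add_le _ _).trans
          (add_le_add_left (AlgHom.norm_apply_le_self p.2 _) _)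
  continuous := continuous_induced_rng.2
    (WeakDual.continuous_of_continuous_eval fun f => (f : G →ᵇ ℂ).continuous)
  map_mul g h := WeakDual.CharacterSpace.ext fun f => by
    rw [smul_apply, toHilbert_apply, toHilbert_apply]
    change _ = (f : G →ᵇ ℂ) (g⁻¹⁻¹ * h)
    rw [inv_inv]
  denseRange := by
    intro x
    by_contra hx
    obtain ⟨F, hF0, hF1, -⟩ := exists_continuous_zero_one_of_isClosed
      (isClosed_closure (s := range (toHilbert (G := G)))) (isClosed_singleton (x := x))
      (disjoint_singleton_right.2 hx)
    obtain ⟨f, hf⟩ := (gelfandTransform_bijective (hilb G)).2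
      (ContinuousMap.comp ⟨Complex.ofReal, Complex.continuous_ofReal⟩ F)
    have hfx : ∀ y : HilbertCompactification G, y f = (F y : ℂ) := fun y => by
      rw [← WeakDual.gelfandTransform_apply_apply, hf]; rfl
    have h0 : f = 0 := by
      ext g
      rw [← toHilbert_apply, hfx, hF0 (subset_closure ⟨g, rfl⟩)]
      simp
    have := hfx x
    rw [h0, map_zero, hF1 rfl] at this
    simp at this

/-- The functions on `G` that factor through `H(G)` are exactly those in `Hilb(G)`. -/
theorem mem_hilb_iff (f : G →ᵇ ℂ) :
    f ∈ hilb G ↔ ∃ F : C(HilbertCompactification G, ℂ), ∀ g, f g = F (toHilbert g) := by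
  constructor
  · exact fun hf => ⟨WeakDual.gelfandTransform ℂ (hilb G) ⟨f, hf⟩, fun g => rfl⟩
  · rintro ⟨F, hF⟩
    obtain ⟨f', rfl⟩ := (gelfandTransform_bijective (hilb G)).2 F
    have : f = f' := by ext g; exact hF g
    rw [this]; exact f'.2

end HilbertCompactification

section ProOligomorphic

/-- `G` is Roelcke precompact: for every neighbourhood `U` of the identity there is a finite set
`F` such that `U F U = G`. -/
def IsRoelckePrecompact (G : Type*) [Group G] [TopologicalSpace G] : Prop :=
  ∀ U ∈ 𝓝 (1 : G), ∃ F : Set G, F.Finite ∧ U * F * U = univ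

/-- A pro-oligomorphic group: a topological group that is non-archimedean (the open subgroups form
a basis at the identity), Polish and Roelcke precompact. -/
structure IsProOligomorphic (G : Type*) [Group G] [TopologicalSpace G] : Prop where
  nonarchimedean : NonarchimedeanGroup G
  polish : PolishSpace G
  roelckePrecompact : IsRoelckePrecompact G

end ProOligomorphic

end HilbertComp
end

/-!
Let `V` be an open subgroup of a Polish Roelcke precompact group `G`. A `V`-invariant function in
`Hilb(G)` is a uniform limit of matrix coefficients `g ↦ ⟨v, π(g) w⟩` in which the representation
and the vector `v` can be kept fixed (`exists_rep_forall_approx`), and `v` can be made `V`-fixed by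
passing to the vector of least norm in the closed convex hull of its `V`-orbit
(`exists_fixed_mem_closure_convexHull`, `exists_average`). The orbit of a `V`-fixed vector is
countable, and by Roelcke precompactness its inner products take finitely many values. The same
finite set contains all inner products of weak limits of the orbit, so these limits are uniformly
separated in norm and lie in a separable space: there are countably many
(`countable_weak_limits`). The value of the function at a point of `H(G)` depends only on such a
weak limit, whence its range is countable (`countable_range_of_invariant`).

If `G` is moreover non-archimedean and `Y` is a factor of `H(G)`, every continuous function on `Y`
is, by right uniform continuity, almost invariant under some open subgroup. Averaging over that
subgroup gives an invariant function on `Y` close to the given one (`exists_invariant_approx`). Its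
range is countable, so it is constant on connected sets. Hence no continuous function separates two
points of a connected subset of `Y`, that is, `Y` is totally disconnected, which for compact
Hausdorff spaces is zero-dimensionality.
-/

noncomputable section

namespace HilbertComp

/-! ### Hilbert spaces -/

section HilbertSpace

variable {H : Type*} [NormedAddCommGroup H] [InnerProductSpace ℂ H] [CompleteSpace H]

/-- A bounded family in a Hilbert space converges weakly along every ultrafilter. -/
theorem exists_tendsto_inner_of_norm_le {ι : Type*} (U : Ultrafilter ι) {a : ι → H} {R : ℝ}
    (ha : ∀ i, ‖a i‖ ≤ R) :
    ∃ c : H, ∀ w : H, Filter.Tendsto (fun i => inner ℂ (a i) w) U (𝓝 (inner ℂ c w)) := by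
  let b : ι → WeakDual ℂ H := fun i => StrongDual.toWeakDual (InnerProductSpace.toDual ℂ H (a i))
  have hb : ∀ i, b i ∈ WeakDual.toStrongDual ⁻¹' Metric.closedBall (0 : StrongDual ℂ H) R := by
    intro i
    simpa [b] using ha i
  obtain ⟨φ, -, hφ⟩ := (WeakDual.isCompact_closedBall (𝕜 := ℂ) (E := H) 0 R).ultrafilter_le_nhds
    (U.map b) (Filter.le_principal_iff.2 (Filter.mem_map.2 (Filter.univ_mem' hb)))
  refine ⟨(InnerProductSpace.toDual ℂ H).symm (WeakDual.toStrongDual φ), fun w => ?_⟩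
  rw [InnerProductSpace.toDual_symm_apply]
  exact ((WeakDual.eval_continuous w).tendsto φ).comp hφ

/-- If the inner products of a countable family take finitely many values, then so do those of its
weak limit points. These are therefore uniformly separated, and as they lie in a separable subspace,
there are only countably many. -/
theorem countable_weak_limits {ι : Type*} {a : ι → H} (ha : (range a).Countable)
    (hD : {z : ℂ | ∃ i j, z = inner ℂ (a i) (a j)}.Finite) :
    {c : H | ∃ U : Ultrafilter ι,
      ∀ w : H, Filter.Tendsto (fun i => inner ℂ (a i) w) U (𝓝 (inner ℂ c w))}.Countable := by
  set D := {z : ℂ | ∃ i j, z = inner ℂ (a i) (a j)} with hDdef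
  set C := {c : H | ∃ U : Ultrafilter ι,
      ∀ w : H, Filter.Tendsto (fun i => inner ℂ (a i) w) U (𝓝 (inner ℂ c w))} with hC
  have hDc : IsClosed D := hD.isClosed
  have h1 : ∀ c ∈ C, ∀ j, inner ℂ c (a j) ∈ D := by
    rintro c ⟨U, hU⟩ j
    exact hDc.mem_of_tendsto (hU (a j)) (Filter.Eventually.of_forall fun i => ⟨i, j, rfl⟩)
  have hDs : ∀ z ∈ D, starRingEnd ℂ z ∈ D := by
    rintro z ⟨i, j, rfl⟩
    exact ⟨j, i, inner_conj_symm _ _⟩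
  -- Taking the two weak limits one after the other keeps inner products in the finite set `D`.
  have h2 : ∀ c ∈ C, ∀ d ∈ C, inner ℂ c d ∈ D := by
    rintro c ⟨U, hU⟩ d hd
    refine hDc.mem_of_tendsto (hU d) (Filter.Eventually.of_forall fun i => ?_)
    rw [← inner_conj_symm]
    exact hDs _ (h1 d hd i)
  have hfin : ((fun p : (ℂ × ℂ) × ℂ => p.1.1.re + p.1.2.re - 2 * p.2.re) ''
      ((D ×ˢ D) ×ˢ D)).Finite := ((hD.prod hD).prod hD).image _
  set S := (fun p : (ℂ × ℂ) × ℂ => p.1.1.re + p.1.2.re - 2 * p.2.re) '' ((D ×ˢ D) ×ˢ D) with hS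
  have h3 : ∀ c ∈ C, ∀ d ∈ C, ‖c - d‖ ^ 2 ∈ S := by
    intro c hc d hd
    refine ⟨((inner ℂ c c, inner ℂ d d), inner ℂ c d), ⟨⟨h2 c hc c hc, h2 d hd d hd⟩,
      h2 c hc d hd⟩, ?_⟩
    rw [norm_sub_sq (𝕜 := ℂ), norm_sq_eq_re_inner (𝕜 := ℂ) c, norm_sq_eq_re_inner (𝕜 := ℂ) d]
    simp only [RCLike.re_to_complex]
    ring
  -- `ε` lies below all positive elements of the finite set `S` of squared distances.
  obtain ⟨ε, hε, hεS⟩ : ∃ ε > 0, ∀ s ∈ S, s < ε → s ≤ 0 := by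
    have : ∀ᶠ x in 𝓝 (0 : ℝ), ∀ s ∈ S, 0 < s → x < s := by
      rw [Filter.eventually_all_finite hfin]
      intro s _
      by_cases h : 0 < s
      · filter_upwards [Iio_mem_nhds h] with x hx _ using hx
      · exact Filter.Eventually.of_forall fun x h' => absurd h' h
    obtain ⟨ε, h, hε⟩ := ((this.filter_mono (nhdsWithin_le_nhds (s := Ioi 0))).and
      self_mem_nhdsWithin).exists
    exact ⟨ε, hε, fun s hs hse => not_lt.1 fun h0 => lt_asymm (h s hs h0) hse⟩
  -- The weak limits lie in the closed span of the family.
  let K := (Submodule.span ℂ (range a)).topologicalClosure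
  have hK : ∀ c ∈ C, c ∈ K := by
    rintro c ⟨U, hU⟩
    have : K = Kᗮᗮ := (Submodule.orthogonal_orthogonal K).symm
    rw [this, Submodule.mem_orthogonal']
    intro w hw
    refine tendsto_nhds_unique (hU w) (tendsto_const_nhds.congr fun i => ?_)
    exact ((Submodule.mem_orthogonal _ _).1 hw _ ((Submodule.le_topologicalClosure _)
      (Submodule.subset_span (mem_range_self i)))).symm
  have hKsep : IsSeparable (K : Set H) := by
    rw [Submodule.topologicalClosure_coe]
    exact (ha.isSeparable.span (R := ℂ)).closure
  have hCsep : IsSeparable C := hKsep.mono hK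
  have : SeparableSpace C := hCsep.separableSpace
  have : DiscreteTopology C := by
    refine DiscreteTopology.of_forall_le_dist (r := Real.sqrt ε) (Real.sqrt_pos.2 hε) ?_
    intro c d hcd
    by_contra! hlt
    rw [Subtype.dist_eq, dist_eq_norm, Real.lt_sqrt (norm_nonneg _)] at hlt
    have := hεS _ (h3 c c.2 d d.2) hlt
    have h0 : ‖(c : H) - d‖ = 0 := by nlinarith [sq_nonneg ‖(c : H) - d‖]
    exact hcd (Subtype.ext (sub_eq_zero.1 (norm_eq_zero.1 h0)))
  have : Countable C := separableSpace_iff_countable.1 inferInstance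
  exact this

/-- The element of minimal norm of the closed convex hull of an orbit is a fixed vector. -/
theorem exists_fixed_mem_closure_convexHull {G : Type*} [Group G] (π : G →* (H ≃ₗᵢ[ℂ] H))
    (V : Subgroup G) (v : H) :
    ∃ v' ∈ closure (convexHull ℝ ((fun u => π u v) '' (V : Set G))), ∀ u ∈ V, π u v' = v' := by
  set A : Set H := (fun u => π u v) '' (V : Set G) with hA
  set K := closure (convexHull ℝ A) with hKdef
  have hconv : Convex ℝ K := (convex_convexHull ℝ A).closure
  have hne : K.Nonempty :=
    ⟨v, subset_closure (subset_convexHull ℝ A ⟨1, V.one_mem, by simp⟩)⟩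
  let _ : InnerProductSpace ℝ H := InnerProductSpace.complexToReal
  obtain ⟨v', hv', hmin⟩ := exists_norm_eq_iInf_of_complete_convex hne
    isClosed_closure.isComplete hconv 0
  have hle : ∀ w ∈ K, ‖v'‖ ≤ ‖w‖ := fun w hw => by
    have := ciInf_le (f := fun w : K => ‖(0 : H) - w‖)
      ⟨0, Set.forall_mem_range.2 fun _ => norm_nonneg _⟩ ⟨w, hw⟩
    rw [← hmin] at this
    simpa using this
  refine ⟨v', hv', fun u hu => ?_⟩
  have hmaps : MapsTo (π u) (convexHull ℝ A) (convexHull ℝ A) := by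
    have himg := ((π u).toLinearEquiv.toLinearMap.restrictScalars ℝ).image_convexHull A
    rw [mapsTo_iff_image_subset]
    refine (subset_of_eq himg).trans (convexHull_mono ?_)
    rintro _ ⟨_, ⟨t, ht, rfl⟩, rfl⟩
    refine ⟨u * t, V.mul_mem hu ht, ?_⟩
    change π (u * t) v = (π u * π t) v
    rw [map_mul]
  have huK : π u v' ∈ K := hmaps.closure (π u).continuous hv'
  -- Otherwise the midpoint of `v'` and `π u v'` would have smaller norm, by strict convexity.
  by_contra hne'
  have hlt := (norm_midpoint_lt_iff (x := v') (y := π u v')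
    ((π u).norm_map v').symm).2 (Ne.symm hne')
  refine absurd (hle _ ?_) (not_le.2 hlt)
  have := hconv hv' huK (a := 1 / 2) (b := 1 / 2) (by norm_num) (by norm_num) (by norm_num)
  rwa [← smul_add] at this

end HilbertSpace

/-! ### Hilbert direct sums of unitary representations -/

section DirectSum

/-- Coordinatewise application of a family of linear isometries to the Hilbert direct sum. -/
def lpMapIsometry {ι : Type*} {E : ι → Type*} [∀ i, NormedAddCommGroup (E i)]
    [∀ i, InnerProductSpace ℂ (E i)] (T : ∀ i, E i ≃ₗᵢ[ℂ] E i) : lp E 2 →ₗᵢ[ℂ] lp E 2 where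
  toFun x := ⟨fun i => T i (x i), (lp.memℓp x).mono' fun i => ((T i).norm_map _).le⟩
  map_add' x y := lp.ext (funext fun i => map_add (T i) (x i) (y i))
  map_smul' c x := lp.ext (funext fun i => map_smul (T i) c (x i))
  norm_map' x := by
    rw [lp.norm_eq_tsum_rpow (by norm_num), lp.norm_eq_tsum_rpow (by norm_num)]
    congr 2
    funext i
    exact congrArg (· ^ _) ((T i).norm_map (x i))

theorem lpMapIsometry_apply {ι : Type*} {E : ι → Type*} [∀ i, NormedAddCommGroup (E i)]
    [∀ i, InnerProductSpace ℂ (E i)] (T : ∀ i, E i ≃ₗᵢ[ℂ] E i) (x : lp E 2) (i : ι) :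
    lpMapIsometry T x i = T i (x i) := rfl

/-- A multiplicative family of linear isometries indexed by a group, as a unitary representation. -/
def repOfIsometries {G : Type*} [Group G] {H : Type*} [NormedAddCommGroup H]
    [InnerProductSpace ℂ H] (U : G → H →ₗᵢ[ℂ] H) (h1 : ∀ x, U 1 x = x)
    (hm : ∀ g h x, U (g * h) x = U g (U h x)) : G →* (H ≃ₗᵢ[ℂ] H) where
  toFun g :=
    { toFun := U g
      invFun := U g⁻¹
      map_add' := map_add _
      map_smul' := map_smul _
      left_inv := fun x => by rw [← hm, inv_mul_cancel, h1]
      right_inv := fun x => by rw [← hm, mul_inv_cancel, h1]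
      norm_map' := (U g).norm_map }
  map_one' := LinearIsometryEquiv.ext h1
  map_mul' g h := LinearIsometryEquiv.ext (hm g h)

/-- The Hilbert direct sum of a family of unitary representations. -/
def lpRep {ι : Type*} {G : Type*} [Group G] {E : ι → Type*} [∀ i, NormedAddCommGroup (E i)]
    [∀ i, InnerProductSpace ℂ (E i)] (π : ∀ i, G →* (E i ≃ₗᵢ[ℂ] E i)) :
    G →* (lp E 2 ≃ₗᵢ[ℂ] lp E 2) :=
  repOfIsometries (fun g => lpMapIsometry fun i => π i g)
    (fun x => lp.ext (funext fun i => by rw [lpMapIsometry_apply, map_one]; rfl))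
    (fun g h x => lp.ext (funext fun i => by
      rw [lpMapIsometry_apply, lpMapIsometry_apply, lpMapIsometry_apply, map_mul]; rfl))

theorem lpRep_apply {ι : Type*} {G : Type*} [Group G] {E : ι → Type*}
    [∀ i, NormedAddCommGroup (E i)] [∀ i, InnerProductSpace ℂ (E i)]
    (π : ∀ i, G →* (E i ≃ₗᵢ[ℂ] E i)) (g : G) (x : lp E 2) (i : ι) :
    lpRep π g x i = π i g (x i) := rfl

end DirectSum

/-! ### Approximation by matrix coefficients -/

section Approximation

variable {G : Type u} [Group G] [TopologicalSpace G]

theorem exists_matrixCoeff_dist_le {f : G →ᵇ ℂ} (hf : f ∈ hilb G) {ε : ℝ} (hε : 0 < ε) :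
    ∃ (H : Type u) (_ : NormedAddCommGroup H) (_ : InnerProductSpace ℂ H) (_ : CompleteSpace H)
      (π : G →* (H ≃ₗᵢ[ℂ] H)) (v w : H), ∀ g, ‖f g - inner ℂ v (π g w)‖ ≤ ε := by
  obtain ⟨f', ⟨H, i1, i2, i3, π, v, w, -, hf'⟩, hff'⟩ := Metric.mem_closure_iff.1 hf ε hε
  refine ⟨H, i1, i2, i3, π, v, w, fun g => ?_⟩
  rw [← hf', ← dist_eq_norm]
  exact (BoundedContinuousFunction.dist_coe_le_dist g).trans hff'.le

/-- A function in `Hilb(G)` is a uniform limit of coefficients of a single unitary representation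
with a single first vector `v`: sum the representations of a sequence of approximants, and let `v`
be the sum of suitably rescaled first vectors. Strong continuity of the sum is not recorded. -/
theorem exists_rep_forall_approx {f : G →ᵇ ℂ} (hf : f ∈ hilb G) :
    ∃ (H : Type u) (_ : NormedAddCommGroup H) (_ : InnerProductSpace ℂ H) (_ : CompleteSpace H)
      (π : G →* (H ≃ₗᵢ[ℂ] H)) (v : H),
      ∀ ε > 0, ∃ w : H, ∀ g, ‖f g - inner ℂ v (π g w)‖ ≤ ε := by
  choose E i1 i2 i3 π v w h using fun n : ℕ =>
    exists_matrixCoeff_dist_le hf (ε := 1 / ((n : ℝ) + 1)) (by positivity)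
  -- Rescaling the first vectors makes them square summable.
  let c : ℕ → ℝ := fun n => (1 / 2) ^ n / (‖v n‖ + 1)
  have hc : ∀ n, 0 < c n := fun n => by positivity
  have hcv : ∀ n, ‖(c n : ℂ) • v n‖ ≤ (1 / 2) ^ n := fun n => by
    rw [norm_smul, Complex.norm_real, Real.norm_of_nonneg (hc n).le, div_mul_eq_mul_div,
      div_le_iff₀ (by positivity)]
    gcongr
    linarith
  have hmem : Memℓp (fun n => (c n : ℂ) • v n) 2 := by
    refine memℓp_gen (Summable.of_nonneg_of_le (fun n => by positivity) (fun n => ?_)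
      (summable_geometric_of_lt_one (r := (1 / 2 : ℝ)) (by norm_num) (by norm_num)))
    have h1 : ((1 : ℝ) / 2) ^ n ≤ 1 := pow_le_one₀ (by norm_num) (by norm_num)
    simp only [ENNReal.toReal_ofNat, Real.rpow_ofNat]
    nlinarith [hcv n, norm_nonneg ((c n : ℂ) • v n)]
  refine ⟨lp E 2, inferInstance, inferInstance, inferInstance, lpRep π,
    ⟨fun n => (c n : ℂ) • v n, hmem⟩, fun ε hε => ?_⟩
  obtain ⟨n, hn⟩ := exists_nat_one_div_lt hε
  refine ⟨lp.single 2 n (((c n)⁻¹ : ℂ) • w n), fun g => ?_⟩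
  have hs : lpRep π g (lp.single 2 n (((c n)⁻¹ : ℂ) • w n)) =
      lp.single 2 n (π n g (((c n)⁻¹ : ℂ) • w n)) := by
    ext i
    rw [lpRep_apply]
    rcases eq_or_ne i n with rfl | hi
    · simp
    · simp [Pi.single_eq_of_ne hi]
  rw [hs, lp.inner_single_right]
  have hc0 : (c n : ℂ) ≠ 0 := by exact_mod_cast (hc n).ne'
  change ‖f g - inner ℂ ((c n : ℂ) • v n) _‖ ≤ ε
  rw [map_smul, inner_smul_left, inner_smul_right, Complex.conj_ofReal,
    mul_inv_cancel_left₀ hc0]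
  exact (h n g).trans hn.le

end Approximation

section HilbertCompactification

variable {G : Type u} [Group G] [TopologicalSpace G] [IsTopologicalGroup G]

/-! ### Averaging over a subgroup -/

theorem convex_setOf_approx {H : Type*} [NormedAddCommGroup H] [InnerProductSpace ℂ H]
    (π : G →* (H ≃ₗᵢ[ℂ] H)) (w : H) (ε : ℝ) :
    Convex ℝ {p : H × (G →ᵇ ℂ) | ∀ g, ‖p.2 g - inner ℂ p.1 (π g w)‖ ≤ ε} := by
  intro p hp q hq a b ha hb hab g
  have key : (a • p + b • q).2 g - inner ℂ (a • p + b • q).1 (π g w) =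
      (a : ℂ) * (p.2 g - inner ℂ p.1 (π g w)) + (b : ℂ) * (q.2 g - inner ℂ q.1 (π g w)) := by
    have h1 : (a • p + b • q).1 = (a : ℂ) • p.1 + (b : ℂ) • q.1 := by simp
    have h2 : (a • p + b • q).2 g = (a : ℂ) * p.2 g + (b : ℂ) * q.2 g := by simp
    rw [h1, h2, inner_add_left, inner_smul_left, inner_smul_left, Complex.conj_ofReal,
      Complex.conj_ofReal]
    ring
  rw [key]
  refine (norm_add_le _ _).trans ?_
  rw [norm_mul, norm_mul, Complex.norm_real, Complex.norm_real, Real.norm_of_nonneg ha,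
    Real.norm_of_nonneg hb]
  calc _ ≤ a * ε + b * ε := by gcongr; exacts [hp g, hq g]
    _ = ε := by rw [← add_mul, hab, one_mul]

theorem isClosed_setOf_approx {H : Type*} [NormedAddCommGroup H] [InnerProductSpace ℂ H]
    (π : G →* (H ≃ₗᵢ[ℂ] H)) (w : H) (ε : ℝ) :
    IsClosed {p : H × (G →ᵇ ℂ) | ∀ g, ‖p.2 g - inner ℂ p.1 (π g w)‖ ≤ ε} := by
  rw [ofPred_forall]
  refine isClosed_iInter fun g => isClosed_le ?_ continuous_const
  exact ((((BoundedContinuousFunction.lipschitz_eval_const g).continuous).comp continuous_snd).sub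
    (continuous_fst.inner continuous_const)).norm

/-- Averaging over a subgroup `V` in `Hilb(G)`: some uniform limit `f'` of convex combinations of
`V`-translates of `f` is a limit of coefficients with one and the same `V`-fixed first vector.
If `f` is a limit of coefficients with first vector `v`, then convex combinations that move `v`
towards a fixed vector of the closed convex hull of its orbit move `f` along a Cauchy sequence. -/
theorem exists_average {f : G →ᵇ ℂ} (hf : f ∈ hilb G) (V : Subgroup G) :
    ∃ f' ∈ closure (convexHull ℝ ((fun u => translate u f) '' (V : Set G))),
      ∃ (H : Type u) (_ : NormedAddCommGroup H) (_ : InnerProductSpace ℂ H) (_ : CompleteSpace H)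
        (π : G →* (H ≃ₗᵢ[ℂ] H)) (v : H), (∀ u ∈ V, π u v = v) ∧
        ∀ ε > 0, ∃ w : H, ∀ g, ‖f' g - inner ℂ v (π g w)‖ ≤ ε := by
  obtain ⟨H, _, _, _, π, v, happ⟩ := exists_rep_forall_approx hf
  obtain ⟨v', hv', hfix⟩ := exists_fixed_mem_closure_convexHull π V v
  -- `Q` consists of the results of applying one convex combination of `V` to both `v` and `f`.
  set Q := convexHull ℝ ((fun u => (π u v, translate u f)) '' (V : Set G)) with hQ
  have hQapp : ∀ ε w, (∀ g, ‖f g - inner ℂ v (π g w)‖ ≤ ε) → ∀ p ∈ Q, ∀ g,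
      ‖p.2 g - inner ℂ p.1 (π g w)‖ ≤ ε := by
    intro ε w hw
    refine convexHull_min ?_ (convex_setOf_approx π w ε)
    rintro _ ⟨u, -, rfl⟩ g
    have := hw (u⁻¹ * g)
    rwa [inner_map_inv_mul] at this
  obtain ⟨a, ha, hav⟩ := mem_closure_iff_seq_limit.1 hv'
  have hfst : ∀ n, ∃ A : G →ᵇ ℂ, (a n, A) ∈ Q := by
    intro n
    have himg := (LinearMap.fst ℝ H (G →ᵇ ℂ)).image_convexHull
      ((fun u => (π u v, translate u f)) '' (V : Set G))
    rw [image_image] at himg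
    have h := ha n
    change a n ∈ convexHull ℝ
      ((fun u => LinearMap.fst ℝ H (G →ᵇ ℂ) (π u v, translate u f)) '' (V : Set G)) at h
    rw [← himg] at h
    obtain ⟨⟨a', A⟩, hA, rfl⟩ := h
    exact ⟨A, hA⟩
  choose A hA using hfst
  have hsnd : ∀ n, A n ∈ convexHull ℝ ((fun u => translate u f) '' (V : Set G)) := by
    intro n
    have himg := (LinearMap.snd ℝ H (G →ᵇ ℂ)).image_convexHull
      ((fun u => (π u v, translate u f)) '' (V : Set G))
    rw [image_image] at himg
    change A n ∈ convexHull ℝ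
      ((fun u => LinearMap.snd ℝ H (G →ᵇ ℂ) (π u v, translate u f)) '' (V : Set G))
    rw [← himg]
    exact ⟨_, hA n, rfl⟩
  have hcauchy : CauchySeq A := by
    refine Metric.cauchySeq_iff.2 fun ε hε => ?_
    obtain ⟨w, hw⟩ := happ (ε / 4) (by positivity)
    obtain ⟨N, hN⟩ := Metric.cauchySeq_iff.1 hav.cauchySeq (ε / 4 / (‖w‖ + 1)) (by positivity)
    refine ⟨N, fun m hm n hn => ?_⟩
    refine ((BoundedContinuousFunction.dist_le (C := 3 * (ε / 4)) (by positivity)).2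
      fun g => ?_).trans_lt (by linarith)
    have e1 := hQapp _ w hw _ (hA m) g
    have e2 := hQapp _ w hw _ (hA n) g
    have e3 : ‖inner ℂ (a m) (π g w) - inner ℂ (a n) (π g w)‖ ≤ ε / 4 := by
      rw [← inner_sub_left]
      refine (norm_inner_le_norm _ _).trans ?_
      have := hN m hm n hn
      rw [dist_eq_norm, lt_div_iff₀ (by positivity)] at this
      rw [(π g).norm_map]
      nlinarith [norm_nonneg (a m - a n)]
    rw [dist_eq_norm]
    calc ‖A m g - A n g‖ = ‖(A m g - inner ℂ (a m) (π g w)) +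
          (inner ℂ (a m) (π g w) - inner ℂ (a n) (π g w)) -
          (A n g - inner ℂ (a n) (π g w))‖ := by congr 1; ring
      _ ≤ _ := (norm_sub_le _ _).trans (add_le_add_left (norm_add_le _ _) _)
      _ ≤ 3 * (ε / 4) := by linarith
  obtain ⟨f', hf'⟩ := cauchySeq_tendsto_of_complete hcauchy
  refine ⟨f', mem_closure_of_tendsto hf' (Filter.Eventually.of_forall hsnd),
    H, inferInstance, inferInstance, inferInstance, π, v', hfix, fun ε hε => ?_⟩
  obtain ⟨w, hw⟩ := happ ε hε
  exact ⟨w, (isClosed_setOf_approx π w ε).mem_of_tendsto (hav.prodMk_nhds hf')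
    (Filter.Eventually.of_forall fun n => hQapp ε w hw _ (hA n))⟩

theorem exists_invariant_average {f : G →ᵇ ℂ} (hf : f ∈ hilb G) (V : Subgroup G) :
    ∃ f' ∈ closure (convexHull ℝ ((fun u => translate u f) '' (V : Set G))),
      ∀ u ∈ V, translate u f' = f' := by
  obtain ⟨f', hmem, H, _, _, _, π, v, hfix, happ⟩ := exists_average hf V
  refine ⟨f', hmem, fun u hu => ?_⟩
  ext g
  rw [translate_apply]
  refine eq_of_forall_dist_le fun ε hε => ?_
  obtain ⟨w, hw⟩ := happ (ε / 2) (by positivity)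
  have h1 := hw (u⁻¹ * g)
  rw [inner_map_inv_mul, hfix u hu, ← dist_eq_norm] at h1
  have h2 := hw g
  rw [← dist_eq_norm] at h2
  linarith [dist_triangle_right (f' (u⁻¹ * g)) (f' g) (inner ℂ v (π g w))]

/-! ### Functions invariant under an open subgroup -/

theorem countable_orbit_of_fixed [SeparableSpace G] {H : Type*} [NormedAddCommGroup H]
    [InnerProductSpace ℂ H] (π : G →* (H ≃ₗᵢ[ℂ] H)) {V : Subgroup G} (hV : IsOpen (V : Set G))
    {v : H} (hfix : ∀ u ∈ V, π u v = v) : (range fun g => π g⁻¹ v).Countable := by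
  have : DiscreteTopology (G ⧸ V) := QuotientGroup.discreteTopology hV
  have : SeparableSpace (G ⧸ V) :=
    (QuotientGroup.mk_surjective (s := V)).denseRange.separableSpace QuotientGroup.continuous_mk
  have : Countable (G ⧸ V) := separableSpace_iff_countable.1 inferInstance
  refine (countable_range fun q : G ⧸ V => π q.out v).mono ?_
  rintro _ ⟨g, rfl⟩
  obtain ⟨u, hu⟩ := QuotientGroup.mk_out_eq_mul V g⁻¹
  refine ⟨(g⁻¹ : G), ?_⟩
  change π (Quotient.out (QuotientGroup.mk (s := V) g⁻¹)) v = _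
  rw [hu, map_mul]
  change π g⁻¹ (π u v) = _
  rw [hfix u u.2]

/-- The inner product of two points in the orbit of a `V`-fixed vector depends on a double coset
of `V` only, and Roelcke precompactness says that there are finitely many of these. -/
theorem finite_inner_of_fixed (hR : IsRoelckePrecompact G) {H : Type*} [NormedAddCommGroup H]
    [InnerProductSpace ℂ H] (π : G →* (H ≃ₗᵢ[ℂ] H)) {V : Subgroup G} (hV : IsOpen (V : Set G))
    {v : H} (hfix : ∀ u ∈ V, π u v = v) :
    {z : ℂ | ∃ g h : G, z = inner ℂ (π g⁻¹ v) (π h⁻¹ v)}.Finite := by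
  obtain ⟨F, hF, hVFV⟩ := hR V (hV.mem_nhds V.one_mem)
  refine (hF.image fun g => inner ℂ v (π g v)).subset ?_
  rintro _ ⟨g, h, rfl⟩
  rw [← inner_map_inv_mul, inv_inv]
  obtain ⟨_, ⟨u, hu, k, hk, rfl⟩, u', hu', he⟩ : g * h⁻¹ ∈ (V : Set G) * F * (V : Set G) :=
    hVFV ▸ mem_univ _
  refine ⟨k, hk, ?_⟩
  rw [← he]
  have h1 : π (u * k * u') v = π (u⁻¹⁻¹ * k) v := by
    rw [inv_inv, map_mul]
    change π (u * k) (π u' v) = _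
    rw [hfix u' hu']
  change inner ℂ v (π k v) = inner ℂ v (π (u * k * u') v)
  rw [h1, inner_map_inv_mul, hfix _ (V.inv_mem hu)]

/-- A point `x` of `H(G)` is a limit of group elements `g` along an ultrafilter, and the value at `x`
of an invariant function depends only on the weak limit of `π(g)⁻¹ v` for one `V`-fixed vector
`v`. There are countably many weak limits. -/
theorem countable_range_of_invariant [SeparableSpace G] (hR : IsRoelckePrecompact G)
    (f : C(HilbertCompactification G, ℂ)) {V : Subgroup G} (hV : IsOpen (V : Set G))
    (hf : ∀ u ∈ V, ∀ x : HilbertCompactification G, f (u⁻¹ • x) = f x) :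
    (range f).Countable := by
  have hα := isCompactification_toHilbert (G := G)
  let f₀ : G →ᵇ ℂ := (BoundedContinuousFunction.mkOfCompact f).compContinuous
    ⟨toHilbert, hα.continuous⟩
  have hf₀ : f₀ ∈ hilb G := (mem_hilb_iff f₀).2 ⟨f, fun g => rfl⟩
  obtain ⟨f', hmem, H, _, _, _, π, v, hfix, happ⟩ := exists_average hf₀ V
  -- As `f₀` is invariant already, averaging does not change it.
  have hf' : f' = f₀ := by
    have : (fun u => translate u f₀) '' (V : Set G) ⊆ {f₀} := by
      rintro _ ⟨u, hu, rfl⟩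
      rw [mem_singleton_iff]
      ext g
      change f (toHilbert (u⁻¹ * g)) = f (toHilbert g)
      rw [hα.map_mul, hf u hu]
    exact closure_minimal (convexHull_min this (convex_singleton f₀)) isClosed_singleton hmem
  rw [hf'] at happ
  -- Every point of `H(G)` is a limit along an ultrafilter on the group, whose image is dense.
  have hU : ∀ x : HilbertCompactification G, ∃ U : Ultrafilter G,
      Filter.Tendsto toHilbert U (𝓝 x) := fun x => by
    have : (Filter.comap toHilbert (𝓝 x)).NeBot :=
      Filter.comap_neBot fun t ht => hα.denseRange.mem_nhds ht
    exact ⟨Ultrafilter.of (Filter.comap toHilbert (𝓝 x)),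
      Filter.tendsto_iff_comap.2 (Ultrafilter.of_le _)⟩
  choose U hU using hU
  choose c hc using fun x => exists_tendsto_inner_of_norm_le (U x) (a := fun g => π g⁻¹ v)
    (R := ‖v‖) (fun g => ((π g⁻¹).norm_map v).le)
  have hcount := countable_weak_limits (countable_orbit_of_fixed π hV hfix)
    (finite_inner_of_fixed hR π hV hfix)
  -- The value of `f` at `x` is determined by the weak limit `c x`.
  have happrox : ∀ ε w, (∀ g, ‖f₀ g - inner ℂ v (π g w)‖ ≤ ε) → ∀ x,
      dist (f x) (inner ℂ (c x) w) ≤ ε := by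
    intro ε w hw x
    refine le_of_tendsto (((f.continuous.tendsto x).comp (hU x)).dist (hc x w))
      (Filter.Eventually.of_forall fun g => ?_)
    have h := inner_map_inv_mul π v w g⁻¹ 1
    rw [inv_inv, mul_one, map_one] at h
    have hg := hw g
    rw [h, ← dist_eq_norm] at hg
    exact hg
  have hdet : ∀ x y, c x = c y → f x = f y := by
    intro x y hxy
    refine eq_of_forall_dist_le fun ε hε => ?_
    obtain ⟨w, hw⟩ := happ (ε / 2) (by positivity)
    have h1 := happrox _ w hw x
    have h2 := happrox _ w hw y
    rw [← hxy] at h2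
    linarith [dist_triangle_right (f x) (f y) (inner ℂ (c x) w)]
  have hrange : (range c).Countable := hcount.mono (by
    rintro _ ⟨x, rfl⟩
    exact ⟨U x, hc x⟩)
  obtain ⟨φ, hφ⟩ := (Function.factorsThrough_iff f).1 fun x y => hdet x y
  rw [hφ, range_comp]
  exact hrange.image φ

/-! ### Factors of the Hilbert compactification -/
/-- On a factor `Y` of `H(G)` the functions invariant under some open subgroup are uniformly dense.
For a continuous function `F`, pick an open subgroup `V` moving `F` by less than `ε` and average `F`
over `V`: the average stays within `ε` of `F`, and it is still a function on `Y` because `C(Y, ℂ)`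
is closed in the bounded functions on `G`. -/
theorem exists_invariant_approx {Y : Type v} [TopologicalSpace Y]
    [CompactSpace Y] [T2Space Y] [MulAction G Y] [ContinuousSMul G Y] {β : G → Y}
    (hβ : IsCompactification β)
    (hfac : IsFactor (toHilbert : G → HilbertCompactification G) β)
    (hG : NonarchimedeanGroup G) (F : C(Y, ℂ)) {ε : ℝ} (hε : 0 < ε) :
    ∃ V : Subgroup G, IsOpen (V : Set G) ∧ ∃ F' : C(Y, ℂ),
      (∀ u ∈ V, ∀ y, F' (u⁻¹ • y) = F' y) ∧ ∀ y, dist (F' y) (F y) ≤ ε := by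
  obtain ⟨p, hp, -, -, hβp⟩ := hfac
  let f : G →ᵇ ℂ := (BoundedContinuousFunction.mkOfCompact F).compContinuous ⟨β, hβ.continuous⟩
  have hf : f ∈ hilb G := (mem_hilb_iff f).2 ⟨F.comp ⟨p, hp⟩, fun g => by
    change F (β g) = F (p (toHilbert g))
    rw [hβp]; rfl⟩
  -- Elements of `Hilb(G)` are right uniformly continuous, so a small subgroup barely moves `f`.
  have hnhds : {g : G | dist (translate g f) f < ε} ∈ 𝓝 (1 : G) := by
    have h1 : translate (1 : G) f = f := by
      ext g
      simp [translate_apply]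
    have := Metric.tendsto_nhds.1 ((continuous_translate hf).tendsto 1) ε hε
    rwa [h1] at this
  obtain ⟨V, hV⟩ := hG.is_nonarchimedean _ hnhds
  obtain ⟨f', hf', hinv⟩ := exists_invariant_average hf (V : Subgroup G)
  -- Restriction along `β` is an isometry on `C(Y, ℂ)`, so its range is closed.
  let ρ : C(Y, ℂ) →ₗ[ℝ] (G →ᵇ ℂ) :=
    { toFun := fun A =>
        (BoundedContinuousFunction.mkOfCompact A).compContinuous ⟨β, hβ.continuous⟩
      map_add' := fun _ _ => rfl
      map_smul' := fun _ _ => rfl }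
  have hρ : Isometry ρ := by
    refine AddMonoidHomClass.isometry_of_norm ρ fun A => le_antisymm ?_ ?_
    · exact (BoundedContinuousFunction.norm_le (norm_nonneg _)).2 fun g => A.norm_coe_le_norm (β g)
    · refine (ContinuousMap.norm_le _ (norm_nonneg _)).2 fun y => ?_
      exact hβ.denseRange.induction_on y (isClosed_le (by fun_prop) continuous_const)
        fun g => (ρ A).norm_coe_le_norm g
  have hclosed : IsClosed (LinearMap.range ρ : Set (G →ᵇ ℂ)) := by
    rw [LinearMap.coe_range]
    exact hρ.isClosedEmbedding.isClosed_range
  have hsub : (fun u => translate u f) '' ((V : Subgroup G) : Set G) ⊆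
      (LinearMap.range ρ : Set (G →ᵇ ℂ)) ∩ Metric.closedBall f ε := by
    rintro _ ⟨u, hu, rfl⟩
    refine ⟨⟨F.comp ⟨fun y => u⁻¹ • y, continuous_const_smul _⟩, ?_⟩,
      Metric.mem_closedBall.2 (le_of_lt (hV hu))⟩
    ext g
    change F (u⁻¹ • β g) = F (β (u⁻¹ * g))
    rw [hβ.map_mul]
  obtain ⟨⟨F', hF'⟩, hball⟩ := closure_minimal (convexHull_min hsub
    ((LinearMap.range ρ).convex.inter (convex_closedBall f ε)))
    (hclosed.inter Metric.isClosed_closedBall) hf'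
  have hF'app : ∀ g, F' (β g) = f' g := fun g => by rw [← hF']; rfl
  refine ⟨V, V.isOpen, F', fun u hu y => ?_, fun y => ?_⟩
  · refine hβ.denseRange.induction_on y (isClosed_eq (F'.continuous.comp
      (continuous_const_smul _)) F'.continuous) fun g => ?_
    rw [← hβ.map_mul, hF'app, hF'app, ← translate_apply, hinv u hu]
  · refine hβ.denseRange.induction_on y (isClosed_le (F'.continuous.dist F.continuous)
      continuous_const) fun g => ?_
    rw [hF'app]
    exact (BoundedContinuousFunction.dist_coe_le_dist (f := f') (g := f) g).trans hball

/-- A continuous function that separates two points of a connected set can be replaced by an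
invariant one, whose range is countable; but the image of a connected set in a countable set of
complex numbers is a point. -/
theorem totallyDisconnectedSpace_of_isFactor {Y : Type v} [TopologicalSpace Y]
    [CompactSpace Y] [T2Space Y] [MulAction G Y] [ContinuousSMul G Y] {β : G → Y}
    (hβ : IsCompactification β)
    (hfac : IsFactor (toHilbert : G → HilbertCompactification G) β)
    (hG : IsProOligomorphic G) : TotallyDisconnectedSpace Y := by
  refine ⟨fun t _ ht x hx y hy => ?_⟩
  by_contra hxy
  obtain ⟨F, hF0, hF1, -⟩ := exists_continuous_zero_one_of_isClosed
    (isClosed_singleton (x := x)) (isClosed_singleton (x := y))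
    (disjoint_singleton.2 hxy)
  obtain ⟨V, hV, F', hinv, hdist⟩ := exists_invariant_approx hβ hfac hG.nonarchimedean
    (ContinuousMap.comp ⟨Complex.ofReal, Complex.continuous_ofReal⟩ F)
    (ε := 1 / 3) (by norm_num)
  obtain ⟨p, hp, hsurj, hequiv, -⟩ := hfac
  have := hG.polish
  have hcount : (range F').Countable := by
    have := countable_range_of_invariant hG.roelckePrecompact (F'.comp ⟨p, hp⟩) hV
      (fun u hu x => by
        change F' (p (u⁻¹ • x)) = F' (p x)
        rw [hequiv, hinv u hu])
    rw [← hsurj.range_comp F']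
    exact this
  have heq : F' x = F' y := hcount.isTotallyDisconnected _ (image_subset_range F' t)
    (ht.image F' F'.continuous.continuousOn) (mem_image_of_mem _ hx) (mem_image_of_mem _ hy)
  have h1 := hdist x
  have h2 := hdist y
  have e0 : F x = 0 := hF0 rfl
  have e1 : F y = 1 := hF1 rfl
  change dist (F' x) ((F x : ℝ) : ℂ) ≤ _ at h1
  change dist (F' y) ((F y : ℝ) : ℂ) ≤ _ at h2
  rw [e0] at h1
  rw [e1, ← heq] at h2
  have h3 := dist_triangle_left ((0 : ℝ) : ℂ) ((1 : ℝ) : ℂ) (F' x)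
  have h4 : dist ((0 : ℝ) : ℂ) ((1 : ℝ) : ℂ) = 1 := by simp
  linarith

end HilbertCompactification

end HilbertComp

end

theorem mainTheorem7 {G : Type u} [Group G] [TopologicalSpace G] [IsTopologicalGroup G] :
    (HilbertComp.IsProOligomorphic G →
      ∀ (Y : Type v) [TopologicalSpace Y] [MulAction G Y] (β : G → Y),
        HilbertComp.IsCompactification β →
        HilbertComp.IsFactor
          (HilbertComp.toHilbert : G → HilbertComp.HilbertCompactification G) β →
        HilbertComp.IsZeroDimensional Y) ∧
    (PolishSpace G → HilbertComp.IsRoelckePrecompact G →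
      ∀ f : C(HilbertComp.HilbertCompactification G, ℂ),
        (∃ V : Subgroup G, IsOpen (V : Set G) ∧
          ∀ v ∈ V, ∀ x : HilbertComp.HilbertCompactification G, f (v⁻¹ • x) = f x) →
        (Set.range f).Countable) := by
  refine ⟨fun hG Y _ _ β hβ hfac => ?_, fun _ hR f ⟨V, hV, hf⟩ =>
    HilbertComp.countable_range_of_invariant hR f hV hf⟩
  have := hβ.compactSpace
  have := hβ.t2Space
  have := hβ.continuousSMul
  have := HilbertComp.totallyDisconnectedSpace_of_isFactor hβ hfac hG
  exact isTopologicalBasis_isClopen
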